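/- A JB$^*$-triple is a complex Banach space $E$ with a continuous triple product $\{a,b,c\}$, linear and symmetric in $a,c$ and conjugate linear in $b$, such that, with $L(a,b)x=\{a,b,x\}$: (1) $L(a,b)L(c,d)-L(c,d)L(a,b)=L(L(a,b)c,d)-L(c,L(b,a)d)$ for all $a,b,c,d\in E$; (2) $L(a,a)$ is a Hermitian operator with non-negative spectrum for every $a\in E$; (3) $\|\{a,a,a\}\|=\|a\|^3$ for every $a\in E$. An element $u$ is a tripotent if $\{u,u,u\}=u$. For a tripotent $u$, let $P_2(u)=L(u,u)(2L(u,u)-\mathrm{id})$ and $P_0(u)=(\mathrm{id}-L(u,u))(\mathrm{id}-2L(u,u))$, and let $E_2(u)=\{x: L(u,u)x=x\}$, which is the range of $P_2(u)$. A non-zero tripotent $u$ is minimal if $E_2(u)=\mathbb{C}u$; then $\phi_u:E\to\mathbb{C}$ is the continuous linear functional determined by $P_2(u)(x)=\phi_u(x)u$. Let $Q(u)x=\{u,x,u\}$ and $E^k(u)=\{x: Q(u)x=kx\}$ for $k\in\{-1,0,1\}$; then $E=E^{-1}(u)\oplus E^0(u)\oplus E^1(u)$, and $P^1(u)=\tfrac12(Q(u)^2+Q(u))$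 is the corresponding (real-linear) projection onto $E^1(u)$. **Proposition.** Let $u$ and $v$ be minimal tripotents in a JB$^*$-triple $E$. Then $P^1(u)(v)=\operatorname{Re}\phi_u(v)\,u$, one has $(1-\operatorname{Re}\phi_u(v))^2\ge\|P_0(u)(v)\|^2$, and $$\|u-v\|^2=(1-\operatorname{Re}\phi_u(v))+\sqrt{(1-\operatorname{Re}\phi_u(v))^2-\|P_0(u)(v)\|^2}.$$ (Thus, identifying $P^1(u)(v)$ with its real coefficient along $u$, $\operatorname{Re}\phi_u(v)$ may be replaced by $P^1(u)(v)$ in the formula.) -/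

import Mathlib

open scoped ComplexConjugate

/-- A continuous triple product on a complex normed space `E`: linear and symmetric in the outer
variables, conjugate linear in the middle one, and jointly continuous. -/
class ContinuousTripleProduct (E : Type*) [NormedAddCommGroup E] [NormedSpace ℂ E] where
  tp : E → E → E → E
  tp_add_left : ∀ a a' b c, tp (a + a') b c = tp a b c + tp a' b c
  tp_smul_left : ∀ (r : ℂ) (a b c : E), tp (r • a) b c = r • tp a b c
  tp_add_middle : ∀ a b b' c, tp a (b + b') c = tp a b c + tp a b' c
  tp_smul_middle : ∀ (r : ℂ) (a b c : E), tp a (r • b) c = conj r • tp a b c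
  tp_symm : ∀ a b c, tp a b c = tp c b a
  tp_continuous : Continuous fun p : E × E × E => tp p.1 p.2.1 p.2.2

namespace JBTriple

/-- A bounded operator `T` on a complex Banach space is Hermitian if `exp (i t T)` is an isometry
for every real `t` (equivalently, its numerical range is real). -/
def IsHermitianOp {E : Type*} [NormedAddCommGroup E] [NormedSpace ℂ E] (T : E →L[ℂ] E) : Prop :=
  ∀ t : ℝ, Isometry (NormedSpace.exp ((Complex.I * (t : ℂ)) • T) : E →L[ℂ] E)

section

variable {E : Type*} [NormedAddCommGroup E] [NormedSpace ℂ E] [ContinuousTripleProduct E]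

/-- The triple product `{a, b, c}`. -/
abbrev tp (a b c : E) : E := ContinuousTripleProduct.tp a b c

/-- The bounded operator `L(a,b) : x ↦ {a, b, x}`. -/
def L (a b : E) : E →L[ℂ] E where
  toFun x := tp a b x
  map_add' x y := by
    simp only [tp]
    rw [ContinuousTripleProduct.tp_symm, ContinuousTripleProduct.tp_add_left,
      ContinuousTripleProduct.tp_symm x, ContinuousTripleProduct.tp_symm y]
  map_smul' r x := by
    simp only [tp, RingHom.id_apply]
    rw [ContinuousTripleProduct.tp_symm, ContinuousTripleProduct.tp_smul_left,
      ContinuousTripleProduct.tp_symm x]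
  cont := ContinuousTripleProduct.tp_continuous.comp
    (continuous_const.prodMk (continuous_const.prodMk continuous_id))

@[simp] theorem L_apply (a b x : E) : L a b x = tp a b x := rfl

end

end JBTriple

/-- JB*-triples: complex Banach spaces with a continuous triple product satisfying the Jordan
identity, positivity of the operators `L(a,a)`, and the norm axiom `‖{a,a,a}‖ = ‖a‖³`. -/
class JBStarTriple (E : Type*) [NormedAddCommGroup E] [NormedSpace ℂ E] [CompleteSpace E]
    extends ContinuousTripleProduct E where
  jordan : ∀ a b c d : E,
    (JBTriple.L a b).comp (JBTriple.L c d) - (JBTriple.L c d).comp (JBTriple.L a b) =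
      JBTriple.L (JBTriple.L a b c) d - JBTriple.L c (JBTriple.L b a d)
  hermitian : ∀ a : E, JBTriple.IsHermitianOp (JBTriple.L a a)
  spectrum_nonneg : ∀ (a : E), ∀ z ∈ spectrum ℂ (JBTriple.L a a), 0 ≤ z.re ∧ z.im = 0
  norm_tp_self : ∀ a : E, ‖JBTriple.tp a a a‖ = ‖a‖ ^ 3

namespace JBTriple

variable {E : Type*} [NormedAddCommGroup E] [NormedSpace ℂ E] [CompleteSpace E] [JBStarTriple E]

/-- `u` is a tripotent: `{u, u, u} = u`. -/
def IsTripotent (u : E) : Prop := tp u u u = u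

/-- The Peirce subspace `E_j(u)`: the eigenspace of `L(u,u)` for the eigenvalue `j/2`. -/
noncomputable def peirceSpace (u : E) (j : Fin 3) : Submodule ℂ E :=
  Module.End.eigenspace (L u u : E →ₗ[ℂ] E) (((j : ℕ) : ℂ) / 2)

/-- The Peirce-2 projection `P₂(u) = L(u,u)(2L(u,u) - id)`. -/
noncomputable def P₂ (u : E) : E →L[ℂ] E :=
  (L u u).comp ((2 : ℂ) • L u u - ContinuousLinearMap.id ℂ E)

/-- The Peirce-0 projection `P₀(u) = (id - L(u,u))(id - 2L(u,u))`. -/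
noncomputable def P₀ (u : E) : E →L[ℂ] E :=
  (ContinuousLinearMap.id ℂ E - L u u).comp (ContinuousLinearMap.id ℂ E - (2 : ℂ) • L u u)

/-- The conjugate linear operator `Q(u) : x ↦ {u, x, u}`. -/
def Q (u x : E) : E := tp u x u

/-- For a tripotent `u`, the projection `P¹(u)` of `E` onto `E¹(u) = {x | Q(u) x = x}` along the
other two summands of the decomposition `E = E⁻¹(u) ⊕ E⁰(u) ⊕ E¹(u)`, where
`Eᵏ(u) = {x | Q(u) x = k x}`. In terms of `Q(u)` it is `(Q(u)² + Q(u)) / 2`. -/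
noncomputable def realPeirceOne (u x : E) : E := (2⁻¹ : ℂ) • (Q u (Q u x) + Q u x)

/-- A minimal tripotent: a non-zero tripotent with `E₂(u) = ℂ u`. -/
structure IsMinimalTripotent (u : E) : Prop where
  ne_zero : u ≠ 0
  tripotent : IsTripotent u
  peirceSpace_two : peirceSpace u 2 = Submodule.span ℂ {u}

/-- The Jordan identity, elementwise. -/
theorem jordan_apply (a b c d e : E) :
    tp a b (tp c d e) = tp (tp a b c) d e - tp c (tp b a d) e + tp c d (tp a b e) := by
  have h := congrArg (fun T : E →L[ℂ] E => T e) (JBStarTriple.jordan a b c d)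
  simp only [sub_apply, ContinuousLinearMap.comp_apply, L_apply] at h
  rw [← h]
  abel

/-- `P₂(u)` takes its values in `E₂(u)`. -/
theorem P₂_mem_peirceSpace {u : E} (hu : IsTripotent u) (x : E) : P₂ u x ∈ peirceSpace u 2 := by
  have hsymm : ∀ a b c : E, tp a b c = tp c b a := ContinuousTripleProduct.tp_symm
  have hu' : tp u u u = u := hu
  have h1 : ∀ y : E, tp u u (tp u y u) = tp u y u := by
    intro y
    have e1 := jordan_apply u y u u u
    have e2 := jordan_apply u u u y u
    rw [hu', hsymm (tp u y u) u u, hsymm y u u] at e1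
    rw [hu'] at e2
    have e3 : (3 : ℂ) • tp u u (tp u y u) = (3 : ℂ) • tp u y u := by
      linear_combination (norm := module) (-1 : ℂ) • e1 + e2
    exact smul_right_injective E (by norm_num : (3 : ℂ) ≠ 0) e3
  have h2 : tp u (tp u x u) u = P₂ u x := by
    have e := jordan_apply x u u u u
    rw [hu', hsymm x u u, hsymm (tp u u x) u u] at e
    have hP : P₂ u x = (2 : ℂ) • tp u u (tp u u x) - tp u u x := by
      simp only [P₂, ContinuousLinearMap.comp_apply, sub_apply,
        smul_apply, ContinuousLinearMap.id_apply, map_sub, map_smul, L_apply]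
    rw [hP]
    linear_combination (norm := module) e
  rw [peirceSpace, Module.End.mem_eigenspace_iff]
  have h3 := h1 (tp u x u)
  rw [h2] at h3
  simpa using h3

/-- For a minimal tripotent `u`, the functional `φ_u` determined by `P₂(u)(x) = φ_u(x) u`. -/
noncomputable def phi {u : E} (hu : IsMinimalTripotent u) : E →L[ℂ] ℂ :=
  (ContinuousLinearEquiv.coord ℂ u hu.ne_zero).comp
    ((P₂ u).codRestrict (Submodule.span ℂ {u})
      (fun x => hu.peirceSpace_two ▸ P₂_mem_peirceSpace hu.tripotent x))

theorem P₂_eq_phi_smul {u : E} (hu : IsMinimalTripotent u) (x : E) :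
    P₂ u x = phi hu x • u := by
  have h := ContinuousLinearEquiv.toSpanNonzeroSingleton_coord ℂ hu.ne_zero
    ((P₂ u).codRestrict (Submodule.span ℂ {u})
      (fun x => hu.peirceSpace_two ▸ P₂_mem_peirceSpace hu.tripotent x) x)
  exact (congrArg Subtype.val h).symm

end JBTriple

/-!
Put `x = u - v`, `σ = 1 - Re φ_u(v)` and `w = P₀(v)u - P₀(u)v`. One has `{x, x, x} = 2σx - w` and
`{x, x, w} = ‖P₀(u)v‖² x`, so `x` lies in a subspace of dimension at most two that is invariant
under `L(x,x)` and on which the characteristic polynomial is `t² - 2σt + ‖P₀(u)v‖²`. The two axioms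
on `L(x,x)` make the roots real and the operator diagonalizable there, and `‖x‖²` is the larger
root: the eigencomponent `y` of `x` for that root satisfies `{y, y, y} = ‖y‖² y`, while the isometry
`exp(itL(x,x))` for a suitable `t` changes the relative sign of the two eigencomponents.

The second identity rests on the symmetry `φ_v({u, u, v}) = φ_u({v, v, u})`, which is equivalent
to `‖P₀(u)v‖ = ‖P₀(v)u‖`. With `p = {u, u, v}` and `q = {v, v, u}`, computing `φ_v({p, v, p})` in
two ways gives `φ_v(p)(φ_u(q) - φ_v(p)) = 0`; adding the relation with `u` and `v` exchanged
gives `(φ_v(p) - φ_u(q))² = 0`.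
-/

namespace JBTriple

/-! ### Hermitian operators -/

section HermitianOperators

theorem exp_apply_of_apply_apply_eq_zero {𝕜 E : Type*} [RCLike 𝕜] [NormedAddCommGroup E]
    [NormedSpace 𝕜 E] [CompleteSpace E] {T : E →L[𝕜] E} {x : E} (h : T (T x) = 0) :
    NormedSpace.exp T x = x + T x := by
  have hseries := (NormedSpace.exp_series_hasSum_exp' (𝕂 := 𝕜) T).mapL
    (ContinuousLinearMap.apply 𝕜 E x)
  have hfinite : HasSum
      (fun n : ℕ => ContinuousLinearMap.apply 𝕜 E x ((n.factorial : 𝕜)⁻¹ • T ^ n))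
      (∑ n ∈ Finset.range 2,
        ContinuousLinearMap.apply 𝕜 E x ((n.factorial : 𝕜)⁻¹ • T ^ n)) := by
    apply hasSum_sum_of_ne_finset_zero
    intro n hn
    obtain ⟨m, rfl⟩ := Nat.exists_eq_add_of_le' (not_lt.mp (Finset.mem_range.not.mp hn))
    simp [pow_add, pow_two, h]
  simpa [Finset.sum_range_succ] using hseries.unique hfinite

theorem exp_smul_apply_of_eigen_add {𝕜 E : Type*} [RCLike 𝕜] [NormedAddCommGroup E]
    [NormedSpace 𝕜 E] [CompleteSpace E] {T : E →L[𝕜] E} {x z : E} {r : 𝕜}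
    (hx : T x = r • x + z) (hz : T z = r • z) (c : 𝕜) :
    NormedSpace.exp (c • T) x = NormedSpace.exp (c * r) • (x + c • z) := by
  let _ : NormedAlgebra ℚ (E →L[𝕜] E) := NormedAlgebra.restrictScalars ℚ 𝕜 _
  set N : E →L[𝕜] E := c • (T - algebraMap 𝕜 (E →L[𝕜] E) r) with hN
  have hsplit : c • T = algebraMap 𝕜 (E →L[𝕜] E) (c * r) + N := by
    rw [hN, smul_sub, Algebra.algebraMap_eq_smul_one, Algebra.algebraMap_eq_smul_one, smul_smul]
    abel
  have hNx : N x = c • z := by simp [hN, Algebra.algebraMap_eq_smul_one, hx]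
  have hNz : N z = 0 := by simp [hN, Algebra.algebraMap_eq_smul_one, hz]
  have hexpN : NormedSpace.exp N x = x + c • z := by
    rw [exp_apply_of_apply_apply_eq_zero (by rw [hNx, map_smul, hNz, smul_zero]), hNx]
  rw [hsplit, NormedSpace.exp_add_of_commute (Algebra.commutes _ _),
    ← NormedSpace.algebraMap_exp_comm, mul_apply_eq_comp, hexpN, Algebra.algebraMap_eq_smul_one]
  simp

theorem mem_spectrum_of_eigen {𝕜 E : Type*} [NontriviallyNormedField 𝕜] [NormedAddCommGroup E]
    [NormedSpace 𝕜 E] {T : E →L[𝕜] E} {x : E} {r : 𝕜} (hx : x ≠ 0) (h : T x = r • x) :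
    r ∈ spectrum 𝕜 T := by
  rw [spectrum.mem_iff]
  intro hunit
  have hinj : Function.Injective (algebraMap 𝕜 (E →L[𝕜] E) r - T) :=
    ((Module.End.isUnit_iff _).mp (hunit.map ContinuousLinearMap.toLinearMapRingHom)).injective
  exact hx (hinj (by simp [Algebra.algebraMap_eq_smul_one, h]))

theorem eq_zero_of_eigen_add_eq_zero {K V : Type*} [Field K] [AddCommGroup V] [Module K V]
    (T : Module.End K V) {x y z : V} {α β γ : K} (hx : T x = α • x) (hy : T y = β • y)
    (hz : T z = γ • z) (hβ : α ≠ β) (hγ : α ≠ γ) (h : x + y + z = 0) : x = 0 := by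
  have h₁ : T (x + y + z) = 0 := by rw [h, map_zero]
  have h₂ : T (T (x + y + z)) = 0 := by rw [h₁, map_zero]
  simp only [map_add, hx, hy, hz, map_smul] at h₁ h₂
  have hprod : ((α - β) * (α - γ)) • x = 0 := by
    linear_combination (norm := module) h₂ - (β + γ) • h₁ + (β * γ) • h
  exact (smul_eq_zero.mp hprod).resolve_left
    (mul_ne_zero (sub_ne_zero.mpr hβ) (sub_ne_zero.mpr hγ))

theorem norm_smul_add_smul_le {E : Type*} [NormedAddCommGroup E] [NormedSpace ℝ E] {y z : E}
    {r s : ℝ} (hrefl : ‖y - z‖ = ‖y + z‖) (hs : |s| ≤ r) : ‖r • y + s • z‖ ≤ r * ‖y + z‖ := by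
  obtain ⟨hneg, hpos⟩ := abs_le.mp hs
  calc ‖r • y + s • z‖ = ‖((r + s) / 2) • (y + z) + ((r - s) / 2) • (y - z)‖ := by
        congr 1
        module
    _ ≤ (r + s) / 2 * ‖y + z‖ + (r - s) / 2 * ‖y - z‖ := by
        refine (norm_add_le _ _).trans_eq ?_
        rw [norm_smul, norm_smul, Real.norm_of_nonneg (by linarith),
          Real.norm_of_nonneg (by linarith)]
    _ = r * ‖y + z‖ := by
        rw [hrefl]
        ring

variable {E : Type*} [NormedAddCommGroup E] [NormedSpace ℂ E] {T : E →L[ℂ] E}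

theorem IsHermitianOp.norm_exp_apply (hT : IsHermitianOp T) (t : ℝ) (x : E) :
    ‖NormedSpace.exp ((Complex.I * (t : ℂ)) • T) x‖ = ‖x‖ :=
  (hT t).norm_map_of_map_zero (map_zero _) x

theorem norm_exp_I_mul_smul (t r : ℝ) (x : E) :
    ‖NormedSpace.exp (Complex.I * (t : ℂ) * (r : ℂ)) • x‖ = ‖x‖ := by
  rw [norm_smul, ← Complex.exp_eq_exp_ℂ, mul_assoc, ← Complex.ofReal_mul,
    Complex.norm_exp_I_mul_ofReal, one_mul]

variable [CompleteSpace E]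

theorem IsHermitianOp.eq_zero_of_eigen_add (hT : IsHermitianOp T) {x z : E} {r : ℝ}
    (hx : T x = (r : ℂ) • x + z) (hz : T z = (r : ℂ) • z) : z = 0 := by
  have hbound (t : ℝ) : |t| * ‖z‖ ≤ 2 * ‖x‖ := by
    have hiso := hT.norm_exp_apply t x
    rw [exp_smul_apply_of_eigen_add hx hz, norm_exp_I_mul_smul] at hiso
    calc |t| * ‖z‖ = ‖(Complex.I * (t : ℂ)) • z‖ := by simp [norm_smul]
      _ = ‖x + (Complex.I * (t : ℂ)) • z - x‖ := by rw [add_sub_cancel_left]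
      _ ≤ ‖x + (Complex.I * (t : ℂ)) • z‖ + ‖x‖ := norm_sub_le _ _
      _ = 2 * ‖x‖ := by rw [hiso, two_mul]
  by_contra hne
  have hpos : 0 < ‖z‖ := norm_pos_iff.mpr hne
  have := hbound ((2 * ‖x‖ + 1) / ‖z‖)
  rw [abs_of_nonneg (by positivity), div_mul_cancel₀ _ hpos.ne'] at this
  linarith

theorem IsHermitianOp.norm_sub_eq_norm_add (hT : IsHermitianOp T) {y z : E} {r s : ℝ}
    (hne : r ≠ s) (hy : T y = (r : ℂ) • y) (hz : T z = (s : ℂ) • z) : ‖y - z‖ = ‖y + z‖ := by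
  have hd : (r : ℂ) - s ≠ 0 := by exact_mod_cast sub_ne_zero.mpr hne
  set t : ℝ := Real.pi / (r - s) with ht
  have hphase : Complex.I * (t : ℂ) * r = Complex.I * t * s + Real.pi * Complex.I := by
    rw [ht]
    push_cast
    field_simp
    ring
  have hexp : NormedSpace.exp ((Complex.I * (t : ℂ)) • T) (y + z)
      = NormedSpace.exp (Complex.I * (t : ℂ) * s) • (z - y) := by
    rw [map_add, exp_smul_apply_of_eigen_add (z := 0) (by rw [hy, add_zero]) (by simp),
      exp_smul_apply_of_eigen_add (x := z) (z := 0) (by rw [hz, add_zero]) (by simp), hphase,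
      ← Complex.exp_eq_exp_ℂ, Complex.exp_add, Complex.exp_pi_mul_I]
    module
  rw [← hT.norm_exp_apply t (y + z), hexp, norm_exp_I_mul_smul, norm_sub_rev]

end HermitianOperators

/-! ### Triple products and the Jordan identity -/

section TripleProduct

variable {E : Type*} [NormedAddCommGroup E] [NormedSpace ℂ E] [ContinuousTripleProduct E]

theorem tp_comm (a b c : E) : tp a b c = tp c b a := ContinuousTripleProduct.tp_symm a b c

theorem tp_add_right (a b c d : E) : tp a b (c + d) = tp a b c + tp a b d :=
  map_add (L a b) c d

theorem tp_sub_right (a b c d : E) : tp a b (c - d) = tp a b c - tp a b d :=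
  map_sub (L a b) c d

theorem tp_smul_right (r : ℂ) (a b c : E) : tp a b (r • c) = r • tp a b c :=
  map_smul (L a b) r c

theorem tp_zero_right (a b : E) : tp a b 0 = 0 := map_zero (L a b)

theorem tp_add_left (a b c d : E) : tp (a + b) c d = tp a c d + tp b c d :=
  ContinuousTripleProduct.tp_add_left a b c d

theorem tp_sub_left (a b c d : E) : tp (a - b) c d = tp a c d - tp b c d := by
  rw [tp_comm, tp_sub_right, tp_comm d, tp_comm d]

theorem tp_smul_left (r : ℂ) (a b c : E) : tp (r • a) b c = r • tp a b c :=
  ContinuousTripleProduct.tp_smul_left r a b c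

theorem tp_zero_left (b c : E) : tp 0 b c = 0 := by rw [tp_comm, tp_zero_right]

theorem tp_add_middle (a b c d : E) : tp a (b + c) d = tp a b d + tp a c d :=
  ContinuousTripleProduct.tp_add_middle a b c d

theorem tp_sub_middle (a b c d : E) : tp a (b - c) d = tp a b d - tp a c d := by
  rw [eq_sub_iff_add_eq, ← tp_add_middle, sub_add_cancel]

theorem tp_smul_middle (r : ℂ) (a b c : E) : tp a (r • b) c = conj r • tp a b c :=
  ContinuousTripleProduct.tp_smul_middle r a b c

theorem tp_zero_middle (a c : E) : tp a 0 c = 0 := by simpa using tp_smul_middle 0 a 0 c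

end TripleProduct

variable {E : Type*} [NormedAddCommGroup E] [NormedSpace ℂ E] [CompleteSpace E] [JBStarTriple E]

theorem tp_tp_middle (x y z : E) : tp x (tp y x z) x = tp x y (tp x z x) := by
  have h₁ := jordan_apply x y x z x
  have h₂ := jordan_apply x z x y x
  rw [tp_comm (tp x y x) z x] at h₁
  rw [tp_comm (tp x z x) y x, tp_comm z x y] at h₂
  linear_combination (norm := module) (3⁻¹ : ℂ) • h₁ + (2 / 3 : ℂ) • h₂

theorem tp_tp_of_eigen {x y z w : E} {α β γ : ℂ} (hy : tp x x y = α • y) (hz : tp x x z = β • z)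
    (hw : tp x x w = γ • w) : tp x x (tp y z w) = (α - conj β + γ) • tp y z w := by
  rw [jordan_apply, hy, hz, hw, tp_smul_left, tp_smul_middle, tp_smul_right]
  module

/-! ### The norm of an element with a quadratic relation -/

section Norm

variable {x y z : E}

theorem nonneg_of_eigen {r : ℂ} (hy : y ≠ 0) (h : tp x x y = r • y) : 0 ≤ r.re ∧ r.im = 0 :=
  JBStarTriple.spectrum_nonneg x r (mem_spectrum_of_eigen hy h)

theorem eq_norm_sq_of_tp_self {r : ℂ} (hx : x ≠ 0) (h : tp x x x = r • x) :
    r = ((‖x‖ ^ 2 : ℝ) : ℂ) := by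
  obtain ⟨hre, him⟩ := nonneg_of_eigen hx h
  obtain ⟨s, rfl⟩ : ∃ s : ℝ, (s : ℂ) = r := ⟨r.re, Complex.ext rfl him.symm⟩
  have hcube : ‖x‖ ^ 3 = s * ‖x‖ := by
    rw [← JBStarTriple.norm_tp_self x, h, norm_smul, Complex.norm_real, 
      Real.norm_of_nonneg (by simpa using hre)]
  congr 1
  refine mul_right_cancel₀ (norm_ne_zero_iff.mpr hx) ?_
  rw [← hcube, pow_succ]

theorem tp_eq_zero_of_eigen {r s : ℝ} (hne : r ≠ s) (hy : tp (y + z) (y + z) y = (r : ℂ) • y)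
    (hz : tp (y + z) (y + z) z = (s : ℂ) • z) : tp y y z = 0 ∧ tp y z y = 0 := by
  have hne' : (r : ℂ) ≠ s := by exact_mod_cast hne
  have hyyy := tp_tp_of_eigen hy hy hy
  have hyyz := tp_tp_of_eigen hy hy hz
  have hyzy := tp_tp_of_eigen hy hz hy
  have hzzy := tp_tp_of_eigen hz hz hy
  simp only [Complex.conj_ofReal, sub_self, zero_add] at hyyy hyyz hyzy hzzy
  have hrest : L (y + z) (y + z) (tp y y y + tp z z y - (r : ℂ) • y)
      = (r : ℂ) • (tp y y y + tp z z y - (r : ℂ) • y) := by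
    rw [L_apply, tp_sub_right, tp_add_right, tp_smul_right, hyyy, hzzy, hy]
    module
  have hsum : tp y y z + tp y z y + (tp y y y + tp z z y - (r : ℂ) • y) = 0 := by
    rw [← hy]
    simp only [tp_add_left, tp_add_middle, tp_comm z y y]
    abel
  constructor
  · refine eq_zero_of_eigen_add_eq_zero (L (y + z) (y + z) : E →ₗ[ℂ] E) hyyz hyzy hrest ?_ hne'.symm
      hsum
    grind
  · refine eq_zero_of_eigen_add_eq_zero (L (y + z) (y + z) : E →ₗ[ℂ] E) hyzy hyyz hrest ?_ ?_
      (by rw [add_comm (tp y z y), hsum])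
    all_goals grind

theorem tp_self_of_eigen {r s : ℝ} (hne : r ≠ s) (hy : tp (y + z) (y + z) y = (r : ℂ) • y)
    (hz : tp (y + z) (y + z) z = (s : ℂ) • z) : tp y y y = (r : ℂ) • y := by
  obtain ⟨hyyz, hyzy⟩ := tp_eq_zero_of_eigen hne hy hz
  obtain ⟨hzzy, -⟩ := tp_eq_zero_of_eigen (y := z) (z := y) hne.symm
    (by rwa [add_comm]) (by rwa [add_comm])
  rw [← hy]
  simp only [tp_add_left, tp_add_middle, tp_comm z y y, hyyz, hyzy, hzzy, add_zero]

theorem norm_sq_add_of_eigen {r s : ℝ} (hlt : s < r) (hy₀ : y ≠ 0)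
    (hy : tp (y + z) (y + z) y = (r : ℂ) • y) (hz : tp (y + z) (y + z) z = (s : ℂ) • z) :
    ‖y + z‖ ^ 2 = r := by
  have hr : r = ‖y‖ ^ 2 := by
    exact_mod_cast eq_norm_sq_of_tp_self hy₀ (tp_self_of_eigen hlt.ne' hy hz)
  rcases eq_or_ne z 0 with rfl | hz₀
  · rw [add_zero, hr]
  have hs : 0 ≤ s := (nonneg_of_eigen hz₀ hz).1
  have hrefl := (JBStarTriple.hermitian (y + z)).norm_sub_eq_norm_add hlt.ne' hy hz
  have hlower : ‖y‖ ≤ ‖y + z‖ := by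
    simpa using norm_smul_add_smul_le (r := 1) (s := 0) hrefl (by simp)
  have hupper : ‖y + z‖ ^ 3 ≤ r * ‖y + z‖ := by
    rw [← JBStarTriple.norm_tp_self, tp_add_right, hy, hz, Complex.coe_smul, Complex.coe_smul]
    exact norm_smul_add_smul_le hrefl (by rw [abs_of_nonneg hs]; exact hlt.le)
  have hpos : 0 < ‖y + z‖ := (norm_pos_iff.mpr hy₀).trans_le hlower
  apply le_antisymm
  · exact le_of_mul_le_mul_right (by rwa [← pow_succ]) hpos
  · rw [hr]
    gcongr

theorem norm_sq_eq_of_quadratic {r s : ℝ} (hle : s ≤ r)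
    (hquad : tp x x (tp x x x - (s : ℂ) • x) = (r : ℂ) • (tp x x x - (s : ℂ) • x))
    (hne : tp x x x ≠ (s : ℂ) • x) : ‖x‖ ^ 2 = r := by
  rcases hle.eq_or_lt with rfl | hlt
  · exact absurd (sub_eq_zero.mp ((JBStarTriple.hermitian x).eq_zero_of_eigen_add
      (by rw [L_apply, add_sub_cancel]) hquad)) hne
  have hd : (r : ℂ) - s ≠ 0 := by exact_mod_cast (sub_pos.mpr hlt).ne'
  obtain ⟨y, hy⟩ : ∃ y, ((r : ℂ) - s) • y = tp x x x - (s : ℂ) • x :=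
    ⟨((r : ℂ) - s)⁻¹ • (tp x x x - (s : ℂ) • x), smul_inv_smul₀ hd _⟩
  obtain ⟨z, rfl⟩ : ∃ z, x = y + z := ⟨x - y, (add_sub_cancel y x).symm⟩
  have hTy : tp (y + z) (y + z) y = (r : ℂ) • y := by
    apply smul_right_injective E hd
    simp only [← tp_smul_right, hy, hquad, smul_comm _ (r : ℂ)]
  refine norm_sq_add_of_eigen hlt ?_ hTy ?_
  · rintro rfl
    exact hne (sub_eq_zero.mp (by rw [← hy, smul_zero]))
  · rw [tp_add_right (y + z), hTy] at hy
    linear_combination (norm := module) -hy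

theorem sq_sub_nonneg_of_quadratic {σ c : ℝ} (hx : x ≠ 0)
    (hquad : tp x x (tp x x x) = ((2 * σ : ℝ) : ℂ) • tp x x x - (c : ℂ) • x) :
    0 ≤ σ ^ 2 - c := by
  obtain ⟨d, hd⟩ := IsAlgClosed.exists_pow_nat_eq ((σ : ℂ) ^ 2 - c) two_pos
  have him : d.im = 0 := by
    by_cases h : tp x x x = ((σ : ℂ) - d) • x
    · simpa using (nonneg_of_eigen hx h).2
    · have heigen : tp x x (tp x x x - ((σ : ℂ) - d) • x)
          = ((σ : ℂ) + d) • (tp x x x - ((σ : ℂ) - d) • x) := by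
        have hc : (c : ℂ) = (σ + d) * (σ - d) := by linear_combination hd
        rw [tp_sub_right, tp_smul_right, hquad, hc]
        push_cast
        module
      simpa using (nonneg_of_eigen (sub_ne_zero.mpr h) heigen).2
  obtain ⟨s, rfl⟩ : ∃ s : ℝ, (s : ℂ) = d := ⟨d.re, Complex.ext rfl him.symm⟩
  have hs : s ^ 2 = σ ^ 2 - c := by exact_mod_cast hd
  exact hs ▸ sq_nonneg s

theorem norm_sq_eq_add_sqrt {w : E} {σ c : ℝ} (hx : x ≠ 0)
    (hxxx : tp x x x = ((2 * σ : ℝ) : ℂ) • x - w) (hw : tp x x w = (c : ℂ) • x)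
    (hdep : ∀ k : ℝ, w = (k : ℂ) • x → c = k * σ) :
    0 ≤ σ ^ 2 - c ∧ ‖x‖ ^ 2 = σ + √(σ ^ 2 - c) := by
  have hdisc : 0 ≤ σ ^ 2 - c := by
    refine sq_sub_nonneg_of_quadratic hx ?_
    simpa only [tp_sub_right, tp_smul_right, hw] using congrArg (tp x x) hxxx
  refine ⟨hdisc, ?_⟩
  obtain ⟨δ, hδ⟩ : ∃ δ, δ = √(σ ^ 2 - c) := ⟨_, rfl⟩
  have hδ₀ : 0 ≤ δ := hδ ▸ Real.sqrt_nonneg _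
  have hc : c = (σ + δ) * (σ - δ) := by rw [hδ]; linear_combination Real.sq_sqrt hdisc
  rw [← hδ]
  by_cases hs : tp x x x = ((σ - δ : ℝ) : ℂ) • x
  · -- Here `w = (σ + δ) x`, so `hdep` and the factorization of `c` force the roots to coincide.
    have hnorm : σ - δ = ‖x‖ ^ 2 := by exact_mod_cast eq_norm_sq_of_tp_self hx hs
    have hpos : 0 < ‖x‖ ^ 2 := by positivity
    have hk : c = (σ + δ) * σ := hdep _ (by
      push_cast at hxxx hs ⊢
      linear_combination (norm := module) hxxx - hs)
    have hδ₁ : δ = 0 := by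
      rcases mul_eq_zero.mp (show (σ + δ) * δ = 0 by linarith) with h | h <;> linarith
    rw [← hnorm, hδ₁, sub_zero, add_zero]
  · refine norm_sq_eq_of_quadratic (by linarith) ?_ hs
    have hw' : tp x x x - ((σ - δ : ℝ) : ℂ) • x = ((σ + δ : ℝ) : ℂ) • x - w := by
      rw [hxxx]
      push_cast
      module
    rw [hw', tp_sub_right, tp_smul_right, hxxx, hw, hc]
    push_cast
    module

end Norm

/-! ### Peirce calculus of a tripotent -/

section Tripotent

variable {u y : E}

/-- The Peirce-1 projection `P₁(u) = 4 L(u,u)(id - L(u,u))`, complementary to `P₂(u)` and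
`P₀(u)` when `u` is a tripotent. -/
noncomputable def P₁ (u : E) : E →L[ℂ] E :=
  (4 : ℂ) • (L u u).comp (ContinuousLinearMap.id ℂ E - L u u)

theorem P₂_apply (u x : E) : P₂ u x = (2 : ℂ) • tp u u (tp u u x) - tp u u x := by
  simp [P₂]

theorem P₁_apply (u x : E) : P₁ u x = (4 : ℂ) • (tp u u x - tp u u (tp u u x)) := by
  simp [P₁]

theorem P₀_apply (u x : E) :
    P₀ u x = x - (3 : ℂ) • tp u u x + (2 : ℂ) • tp u u (tp u u x) := by
  simp only [P₀, ContinuousLinearMap.comp_apply, sub_apply, smul_apply,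
    ContinuousLinearMap.id_apply, map_sub, map_smul, L_apply]
  module

theorem P₂_add_P₁_add_P₀ (u x : E) : P₂ u x + P₁ u x + P₀ u x = x := by
  rw [P₂_apply, P₁_apply, P₀_apply]
  module

theorem P₀_of_eigen {α : ℂ} (h : tp u u y = α • y) :
    P₀ u y = ((1 - α) * (1 - 2 * α)) • y := by
  rw [P₀_apply, h, tp_smul_right, h]
  module

namespace IsTripotent

theorem tp_tp_middle_self (hu : IsTripotent u) (x : E) : tp u (tp u x u) u = P₂ u x := by
  have h := jordan_apply x u u u u
  rw [hu, tp_comm x u u, tp_comm (tp u u x) u u] at h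
  rw [P₂_apply]
  linear_combination (norm := module) h

theorem tp_self_tp_middle (hu : IsTripotent u) (x : E) : tp u u (tp u x u) = tp u x u := by
  have h₁ := jordan_apply u u u x u
  have h₂ := tp_tp_middle u u x
  rw [hu] at h₁
  linear_combination (norm := module) (2⁻¹ : ℂ) • (h₁ - h₂)

theorem tp_self_P₂ (hu : IsTripotent u) (x : E) : tp u u (P₂ u x) = P₂ u x := by
  rw [← hu.tp_tp_middle_self, hu.tp_self_tp_middle]

theorem tp_self_P₁ (hu : IsTripotent u) (x : E) : tp u u (P₁ u x) = (1 / 2 : ℂ) • P₁ u x := by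
  have h := hu.tp_self_P₂ x
  simp only [P₂_apply, tp_sub_right, tp_smul_right] at h
  simp only [P₁_apply, tp_smul_right, tp_sub_right]
  linear_combination (norm := module) (-2 : ℂ) • h

theorem tp_self_P₀ (hu : IsTripotent u) (x : E) : tp u u (P₀ u x) = 0 := by
  have h := hu.tp_self_P₂ x
  simp only [P₂_apply, tp_sub_right, tp_smul_right] at h
  simp only [P₀_apply, tp_add_right, tp_sub_right, tp_smul_right]
  linear_combination (norm := module) h

theorem tp_orth_self (hu : IsTripotent u) (hy : tp u u y = 0) : tp u y u = 0 := by
  have h := tp_tp_middle u u y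
  rwa [hy, tp_zero_middle, hu.tp_self_tp_middle, eq_comm] at h

theorem tp_orth (hu : IsTripotent u) (hy : tp u u y = 0) (z : E) : tp u y z = 0 := by
  have h₁ := jordan_apply u y u u z
  have h₂ := jordan_apply u u u y z
  rw [hu.tp_orth_self hy, tp_comm y u u, hy, tp_zero_left, tp_zero_middle] at h₁
  rw [hu, hy, tp_zero_middle] at h₂
  linear_combination (norm := module) -h₂ - h₁

theorem orth_tp (hu : IsTripotent u) (hy : tp u u y = 0) (z : E) : tp y u z = 0 := by
  have h₁ := jordan_apply y u u u z
  have h₂ := jordan_apply u u y u z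
  rw [tp_comm y u u, hy, hu.tp_orth_self hy, tp_zero_left, tp_zero_middle] at h₁
  rw [hy, hu, tp_zero_left] at h₂
  linear_combination (norm := module) h₂ + h₁

theorem P₂_orth (hu : IsTripotent u) (hy : tp u u y = 0) (x z : E) : tp (P₂ u x) y z = 0 := by
  have h := jordan_apply u (tp u x u) u y z
  rw [hu.tp_tp_middle_self, tp_comm (tp u x u) u y, hu.orth_tp hy, hu.tp_orth hy, hu.tp_orth hy,
    tp_zero_right, tp_zero_middle, sub_zero, add_zero] at h
  exact h.symm

theorem P₀_tp_orth (hu : IsTripotent u) (hy : tp u u y = 0) (x : E) :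
    P₀ u (tp x y x) = tp (P₀ u x) y (P₀ u x) := by
  have hy₀ : tp u u y = (0 : ℂ) • y := by rw [hy, zero_smul]
  have hx₁ := hu.tp_self_P₁ x
  have hx₀ : tp u u (P₀ u x) = (0 : ℂ) • P₀ u x := by rw [hu.tp_self_P₀, zero_smul]
  have hexpand : tp x y x = tp (P₁ u x) y (P₁ u x) + (2 : ℂ) • tp (P₁ u x) y (P₀ u x)
      + tp (P₀ u x) y (P₀ u x) := by
    nth_rewrite 1 2 [← P₂_add_P₁_add_P₀ u x]
    simp only [tp_add_left, tp_add_right, tp_comm _ y (P₂ u x), hu.P₂_orth hy,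
      tp_comm (P₀ u x) y (P₁ u x)]
    module
  rw [hexpand, map_add, map_add, map_smul, P₀_of_eigen (tp_tp_of_eigen hx₁ hy₀ hx₁),
    P₀_of_eigen (tp_tp_of_eigen hx₁ hy₀ hx₀), P₀_of_eigen (tp_tp_of_eigen hx₀ hy₀ hx₀), map_zero]
  module

end IsTripotent

end Tripotent

/-! ### Minimal tripotents -/

namespace IsMinimalTripotent

variable {u v : E}

theorem tp_tp_self (hu : IsMinimalTripotent u) (x : E) :
    tp u u (tp u u x) = (1 / 2 : ℂ) • (tp u u x + phi hu x • u) := by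
  rw [← P₂_eq_phi_smul hu, P₂_apply]
  module

theorem P₀_apply (hu : IsMinimalTripotent u) (x : E) :
    P₀ u x = x - (2 : ℂ) • tp u u x + phi hu x • u := by
  rw [JBTriple.P₀_apply, hu.tp_tp_self]
  module

theorem tp_middle (hu : IsMinimalTripotent u) (x : E) : tp u x u = conj (phi hu x) • u := by
  have hmem : tp u x u ∈ peirceSpace u 2 := by
    simpa [peirceSpace, Module.End.mem_eigenspace_iff] using hu.tripotent.tp_self_tp_middle x
  rw [hu.peirceSpace_two, Submodule.mem_span_singleton] at hmem
  obtain ⟨k, hk⟩ := hmem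
  have hquad := hu.tripotent.tp_tp_middle_self x
  rw [← hk, tp_smul_middle, hu.tripotent, P₂_eq_phi_smul hu] at hquad
  rw [← hk, ← smul_left_injective ℂ hu.ne_zero hquad, Complex.conj_conj]

theorem realPeirceOne_eq (hu : IsMinimalTripotent u) (x : E) :
    realPeirceOne u x = ((phi hu x).re : ℂ) • u := by
  rw [realPeirceOne, Q, Q, hu.tripotent.tp_tp_middle_self, P₂_eq_phi_smul hu, hu.tp_middle,
    Complex.re_eq_add_conj]
  module

theorem phi_self (hu : IsMinimalTripotent u) : phi hu u = 1 := by
  have h := hu.tp_middle u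
  rw [hu.tripotent] at h
  have h₁ := smul_left_injective ℂ hu.ne_zero ((one_smul ℂ u).trans h)
  rw [← Complex.conj_conj (phi hu u), ← h₁, map_one]

theorem P₀_self (hu : IsMinimalTripotent u) : P₀ u u = 0 := by
  rw [P₀_of_eigen (α := 1) (by rw [hu.tripotent, one_smul]), sub_self, zero_mul, zero_smul]

theorem phi_P₀_self (hu : IsMinimalTripotent u) (x : E) : phi hu (P₀ u x) = 0 := by
  have h : phi hu (P₀ u x) • u = 0 := by
    rw [← P₂_eq_phi_smul, P₂_apply, hu.tripotent.tp_self_P₀, tp_zero_right, smul_zero, sub_zero]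
  exact (smul_eq_zero.mp h).resolve_right hu.ne_zero

theorem phi_tp_self (hu : IsMinimalTripotent u) (x : E) : phi hu (tp u u x) = phi hu x := by
  have h := hu.tp_tp_self (tp u u x)
  rw [hu.tp_tp_self x, tp_smul_right, tp_add_right, tp_smul_right, hu.tripotent,
    hu.tp_tp_self x] at h
  refine smul_left_injective ℂ hu.ne_zero ?_
  linear_combination (norm := module) (-2 : ℂ) • h

theorem phi_tp_middle_self (hu : IsMinimalTripotent u) (x : E) :
    phi hu (tp x u x) = phi hu x ^ 2 := by
  have h := tp_tp_middle u x x
  simp only [hu.tp_middle, tp_smul_right, smul_smul] at h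
  have h₁ := congrArg conj (smul_left_injective ℂ hu.ne_zero h)
  rwa [map_mul, Complex.conj_conj, Complex.conj_conj, ← sq] at h₁

theorem phi_symm (hu : IsMinimalTripotent u) (hv : IsMinimalTripotent v) :
    phi hv u = conj (phi hu v) := by
  have huv := hu.phi_tp_middle_self v
  have hvu := congrArg conj (hv.phi_tp_middle_self u)
  rw [hv.tp_middle, map_smul, smul_eq_mul] at huv
  rw [hu.tp_middle, map_smul, smul_eq_mul, map_mul, Complex.conj_conj, map_pow] at hvu
  have h : conj (phi hv u) = phi hu v :=
    sub_eq_zero.mp (sq_eq_zero_iff.mp (by linear_combination -huv - hvu))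
  rw [← h, Complex.conj_conj]

theorem tp_self_tp_symm (hu : IsMinimalTripotent u) (x : E) :
    tp u u (tp x x u) = (1 / 2 : ℂ) • (tp x x u + conj (phi hu (tp x x u)) • u) := by
  have h := jordan_apply x x u u u
  rw [hu.tripotent, hu.tp_middle, tp_comm (tp x x u) u u] at h
  linear_combination (norm := module) (-(1 / 2) : ℂ) • h

theorem conj_phi_tp (hu : IsMinimalTripotent u) (x : E) :
    conj (phi hu (tp x x u)) = phi hu (tp x x u) := by
  have h := hu.tp_tp_self (tp x x u)
  rw [hu.tp_self_tp_symm, tp_smul_right, tp_add_right, tp_smul_right, hu.tripotent,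
    hu.tp_self_tp_symm] at h
  refine smul_left_injective ℂ hu.ne_zero ?_
  linear_combination (norm := module) (2 : ℂ) • h

theorem tp_right_tp_self (hu : IsMinimalTripotent u) (x : E) :
    tp u x (tp u u x)
      = (1 / 2 : ℂ) • (phi hu (tp x x u) • u + conj (phi hu x) • tp u u x) := by
  have h := jordan_apply x u u x u
  rw [hu.tp_middle x, tp_smul_right, tp_comm x u u, tp_comm u x x, hu.tp_middle,
    hu.conj_phi_tp, tp_comm (tp u u x) x u] at h
  linear_combination (norm := module) (-(1 / 2) : ℂ) • h

theorem tp_middle_tp_self (hu : IsMinimalTripotent u) (x : E) :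
    tp u (tp u u x) x = (1 / 2 : ℂ) • (tp x x u + conj (phi hu x) • tp u u x) := by
  have h := jordan_apply u x x u u
  rw [tp_comm x u u, hu.tp_right_tp_self, tp_comm u x x, tp_comm (tp x x u) u u,
    hu.tp_self_tp_symm, hu.conj_phi_tp, hu.tp_middle, tp_smul_right, tp_comm x (tp u u x) u,
    tp_comm x u u] at h
  linear_combination (norm := module) h

theorem tp_tp_self_of_tripotent (hu : IsMinimalTripotent u) (hv : IsTripotent v) :
    tp u v (tp v v u) = (conj (phi hu v) / 2) • (tp v v u + u) := by
  have h := jordan_apply v v u v u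
  rw [hv, hu.tp_middle, tp_smul_right, tp_comm (tp v v u) v u] at h
  linear_combination (norm := module) (-(1 / 2) : ℂ) • h

theorem tp_P₀_self (hv : IsMinimalTripotent v) (hu : IsTripotent u) :
    tp (P₀ u v) (P₀ u v) (P₀ u v) = conj (phi hv (P₀ u v)) • P₀ u v := by
  rw [← hu.P₀_tp_orth (hu.tp_self_P₀ v), hv.tp_middle, map_smul]

theorem phi_P₀_eq_norm_sq (hv : IsMinimalTripotent v) (hu : IsTripotent u) :
    phi hv (P₀ u v) = ((‖P₀ u v‖ ^ 2 : ℝ) : ℂ) := by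
  rcases eq_or_ne (P₀ u v) 0 with h | h
  · simp [h]
  · rw [← Complex.conj_conj (phi hv (P₀ u v)), eq_norm_sq_of_tp_self h (hv.tp_P₀_self hu),
      Complex.conj_ofReal]

section Pair

variable (hu : IsMinimalTripotent u) (hv : IsMinimalTripotent v)

include hu hv

theorem tp_tp_self_middle_self :
    tp (tp u u v) v (tp u u v)
      = ((phi hv (tp u u v) + phi hu (tp v v u)) / 2) • tp u u v
        - (phi hu v / 2) • tp v v u
        + (phi hu v / 4) • (u + conj (phi hu v) • v) := by
  have h := jordan_apply (tp u u v) v u u v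
  rw [tp_comm (tp u u v) v u, hu.tp_right_tp_self, tp_comm v (tp u u v) u, hu.tp_middle_tp_self,
    tp_comm (tp u u v) v v, hv.tp_self_tp_symm, hv.conj_phi_tp] at h
  simp only [tp_smul_left, tp_add_left, tp_smul_middle, tp_add_middle, tp_smul_right,
    tp_add_right, tp_comm (tp u u v) u v, hv.tp_tp_self_of_tripotent hu.tripotent,
    tp_comm u (tp v v u) v, hv.tp_middle_tp_self, hu.tp_middle_tp_self, hu.tp_tp_self,
    hu.phi_symm hv, Complex.conj_conj, map_div₀, map_one, map_ofNat] at h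
  rw [h]
  module

theorem phi_tp_mul_sub :
    phi hv (tp u u v) * (phi hu (tp v v u) - phi hv (tp u u v)) = 0 := by
  have h := hv.phi_tp_middle_self (tp u u v)
  rw [hu.tp_tp_self_middle_self hv] at h
  simp only [map_add, map_sub, map_smul, smul_eq_mul, hv.phi_tp_self, hv.phi_self,
    hu.phi_symm hv] at h
  linear_combination 2 * h

theorem phi_tp_symm : phi hv (tp u u v) = phi hu (tp v v u) := by
  have huv := hu.phi_tp_mul_sub hv
  have hvu := hv.phi_tp_mul_sub hu
  exact sub_eq_zero.mp (sq_eq_zero_iff.mp (by linear_combination -huv - hvu))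

theorem phi_P₀ : phi hv (P₀ u v) = 1 + phi hu v * conj (phi hu v) - 2 * phi hv (tp u u v) := by
  rw [hu.P₀_apply, map_add, map_sub, map_smul, map_smul, hv.phi_self, hu.phi_symm hv,
    smul_eq_mul, smul_eq_mul]
  ring

theorem phi_P₀_symm : phi hv (P₀ u v) = phi hu (P₀ v u) := by
  rw [hu.phi_P₀ hv, hv.phi_P₀ hu, hu.phi_tp_symm hv, hu.phi_symm hv, Complex.conj_conj]
  ring

theorem tp_sub_self_self :
    tp (u - v) (u - v) (u - v) =
      ((2 * (1 - (phi hu v).re) : ℝ) : ℂ) • (u - v) - (P₀ v u - P₀ u v) := by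
  have hre : ((2 * (1 - (phi hu v).re) : ℝ) : ℂ) = 2 - phi hu v - conj (phi hu v) := by
    push_cast
    rw [Complex.re_eq_add_conj]
    ring
  have huu : tp u u u = u := hu.tripotent
  have hvv : tp v v v = v := hv.tripotent
  rw [hre, hu.P₀_apply, hv.P₀_apply, hu.phi_symm hv]
  simp only [tp_sub_left, tp_sub_right, tp_sub_middle, huu, hvv, hu.tp_middle,
    hv.tp_middle, hu.phi_symm hv, Complex.conj_conj, tp_comm v u u, tp_comm u v v]
  module

theorem tp_sub_sub_P₀ :
    tp (u - v) (u - v) (P₀ v u - P₀ u v) = ((‖P₀ u v‖ ^ 2 : ℝ) : ℂ) • (u - v) := by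
  have huu : tp u u u = u := hu.tripotent
  have hvv : tp v v v = v := hv.tripotent
  rw [← hv.phi_P₀_eq_norm_sq hu.tripotent, hu.phi_P₀ hv, hu.P₀_apply, hv.P₀_apply]
  simp only [tp_sub_left, tp_sub_right, tp_sub_middle, tp_add_right, tp_smul_right, huu, hvv,
    hu.tp_middle, hv.tp_middle, tp_comm v u u, tp_comm u v v, hu.tp_tp_self, hv.tp_tp_self,
    hu.tp_self_tp_symm, hv.tp_self_tp_symm, hu.tp_right_tp_self, hv.tp_right_tp_self,
    hu.tp_tp_self_of_tripotent hv.tripotent, hv.tp_tp_self_of_tripotent hu.tripotent,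
    hv.conj_phi_tp, hu.phi_symm hv, ← hu.phi_tp_symm hv, Complex.conj_conj]
  module

end Pair

end IsMinimalTripotent

end JBTriple


theorem proposition3p3 {E : Type*} [NormedAddCommGroup E] [NormedSpace ℂ E] [CompleteSpace E]
    [JBStarTriple E] (u v : E) (hu : JBTriple.IsMinimalTripotent u)
    (hv : JBTriple.IsMinimalTripotent v) :
    JBTriple.realPeirceOne u v = ((JBTriple.phi hu v).re : ℂ) • u ∧
    0 ≤ (1 - (JBTriple.phi hu v).re) ^ 2 - ‖JBTriple.P₀ u v‖ ^ 2 ∧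
    ‖u - v‖ ^ 2 = (1 - (JBTriple.phi hu v).re) +
      Real.sqrt ((1 - (JBTriple.phi hu v).re) ^ 2 - ‖JBTriple.P₀ u v‖ ^ 2) := by
  refine ⟨hu.realPeirceOne_eq v, ?_⟩
  rcases eq_or_ne u v with rfl | hne
  · simp [hu.P₀_self, hu.phi_self]
  · refine JBTriple.norm_sq_eq_add_sqrt (sub_ne_zero.mpr hne) (hu.tp_sub_self_self hv)
      (hu.tp_sub_sub_P₀ hv) fun k hk => ?_
    have hphi : ((‖JBTriple.P₀ u v‖ ^ 2 : ℝ) : ℂ) = k * (1 - JBTriple.phi hu v) := by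
      simpa only [map_sub, map_smul, smul_eq_mul, hu.phi_self, hu.phi_P₀_self, sub_zero,
        ← hu.phi_P₀_symm hv, hv.phi_P₀_eq_norm_sq hu.tripotent] using
        congrArg (JBTriple.phi hu) hk
    simpa [-Complex.ofReal_pow] using congrArg Complex.re hphi
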